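/- All graphs are finite and may have loops and parallel edges; $V(G)$ and $E(G)$ are the sets of vertices and edges of $G$, and $\Delta G=|E(G)|-|V(G)|$. For $X\subseteq E(G)$, $G\langle X\rangle$ is the subgraph of $G$ formed by the edges in $X$ and their end vertices. A cacti-graph is a graph with no isolated vertices, no leaves (vertices of degree $1$, where a loop adds $2$ to the degree) and no components that are cycles (a loop at one vertex, and two parallel edges on two vertices, are cycles). For an integer $k\ge 1$ let $\mathcal C_k(G)$ be the set of all $C\subseteq E(G)$ such that $G\langle C\rangle$ is a cacti-graph and $\Delta G\langle C\rangle=k$. This is the set of circuits of a matroid on $E(G)$, the $k$-circular matroid $M_k(G)$; let $\rho^*_k(G)$ be its corank, that is, the rank of its dual. For a vertex $x$ let $S(x,G)$ be the set of edges incident to $x$, let $s(x,G)=|S(x,G)|$, and let $\mathcal S(G)=\{S(x,G):x\in V(G)\}$. A graph is $3$-connected if it has at least four vertices and remains connected after the deletion of any set of at most two vertices. Graphs $G$ and $G'$ with $E(G)=E(G')$ are strongly isomorphic if there is a bijection $\nu:V(G)\to V(G')$ such that, for every edge $e$ and all $x,y\in V(G)$, $e$ has ends $x,y$ in $G$ if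 and only if $e$ has ends $\nu(x),\nu(y)$ in $G'$. Theorem. Let $G$ and $G'$ be graphs and let $k\ge 1$. Suppose that $G$ is $3$-connected, $\mathcal C_k(G)\neq\emptyset$, $s(x,G)\le\rho^*_k(G)$ for every vertex $x$ of $G$, $G'$ has no isolated vertices, and $M_k(G')=M_k(G)$. Then $\mathcal S(G)=\mathcal S(G')$, and $G$ and $G'$ are strongly isomorphic. -/

import Mathlib

open scoped Graph

namespace Graph

/-! ### Finite multigraphs (loops and parallel edges allowed) -/

/-- The set of end vertices of the edges in `X`. -/
def ends {α β : Type*} (G : Graph α β) (X : Set β) : Set α :=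
  {v | ∃ e ∈ X, G.Inc e v}

/-- The subgraph `G⟨X⟩` induced by a set `X` of edges: its edges are the edges of `G` in `X`,
its vertices are the end vertices of these edges. -/
def edgeInduce {α β : Type*} (G : Graph α β) (X : Set β) : Graph α β :=
  (G.restrict X).induce (G.ends X)

/-- The vertex star `S(x, G)`: the set of edges of `G` incident to `x`. -/
def vertexStar {α β : Type*} (G : Graph α β) (x : α) : Set β :=
  {e | G.Inc e x}

/-- The set of vertex stars of `G`. -/
def vertexStars {α β : Type*} (G : Graph α β) : Set (Set β) :=
  {S | ∃ x ∈ V(G), G.vertexStar x = S}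

/-- `ΔG = |E(G)| - |V(G)|`, for a finite graph `G`. -/
noncomputable def excess {α β : Type*} (G : Graph α β) : ℤ :=
  (E(G).ncard : ℤ) - (V(G).ncard : ℤ)

/-- The degree of a vertex; a loop contributes two. -/
noncomputable def deg {α β : Type*} (G : Graph α β) (x : α) : ℕ∞ :=
  (G.vertexStar x).encard + {e | G.IsLoopAt e x}.encard

/-- A graph is connected if it has a vertex and any two vertices are joined by a path. -/
def IsConnected {α β : Type*} (G : Graph α β) : Prop :=
  V(G).Nonempty ∧ ∀ x ∈ V(G), ∀ y ∈ V(G), Relation.ReflTransGen G.Adj x y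

/-- `H` is a component of `G`: a connected subgraph closed under adjacency and incidence in `G`. -/
def IsComponentOf {α β : Type*} (H G : Graph α β) : Prop :=
  H.IsClosedSubgraph G ∧ H.IsConnected

/-- A cycle: a finite connected graph in which all vertices have degree two. One vertex with a loop
and two vertices joined by two parallel edges are cycles. -/
def IsCycleGraph {α β : Type*} (G : Graph α β) : Prop :=
  V(G).Finite ∧ G.IsConnected ∧ ∀ x ∈ V(G), G.deg x = 2

/-- A cacti-graph: no isolated vertices, no leaves, no cycle components. -/
structure IsCactiGraph {α β : Type*} (G : Graph α β) : Prop where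
  no_isolated : ∀ x ∈ V(G), G.deg x ≠ 0
  no_leaf : ∀ x ∈ V(G), G.deg x ≠ 1
  no_cycle_component : ∀ H : Graph α β, H.IsComponentOf G → ¬ H.IsCycleGraph

/-- `G` is `n`-connected: it has more than `n` vertices and remains connected after the deletion
of any set of fewer than `n` vertices. -/
def IsNConnected {α β : Type*} (G : Graph α β) (n : ℕ) : Prop :=
  (n : ℕ∞) < V(G).encard ∧
    ∀ X ⊆ V(G), X.encard < (n : ℕ∞) → (G.deleteVerts X).IsConnected

/-- Graphs with the same edge set are strongly isomorphic if some bijection of the vertex sets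
respects the ends of every edge. -/
def StronglyIsomorphic {α α' β : Type*} (G : Graph α β) (G' : Graph α' β) : Prop :=
  E(G) = E(G') ∧ ∃ ν : V(G) ≃ V(G'), ∀ (e : β) (x y : V(G)),
    G.IsLink e x y ↔ G'.IsLink e (ν x) (ν y)

/-- The family `C_k(G)` of `k`-circuits of `G`: the finite edge sets `C` such that `G⟨C⟩` is a
cacti-graph with `ΔG⟨C⟩ = k`. -/
def kCircuits {α β : Type*} (G : Graph α β) (k : ℕ) : Set (Set β) :=
  {C | C ⊆ E(G) ∧ C.Finite ∧ (G.edgeInduce C).excess = k ∧ (G.edgeInduce C).IsCactiGraph}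

/-! ### The `k`-circular matroid -/

theorem ends_finite {α β : Type*} (G : Graph α β) {X : Set β} (hX : X.Finite) :
    (G.ends X).Finite := by
  classical
  have h : G.ends X = ⋃ e ∈ X, {v | G.Inc e v} := by
    ext v; simp [ends]
  rw [h]
  refine hX.biUnion fun e _ ↦ ?_
  by_cases he : e ∈ E(G)
  · obtain ⟨x, y, hxy⟩ := G.exists_isLink_of_mem_edgeSet he
    refine (Set.toFinite {x, y}).subset fun v hv ↦ ?_
    simpa using Inc.eq_or_eq_of_isLink hv hxy
  · refine Set.finite_empty.subset fun v hv ↦ (he (Inc.edge_mem hv)).elim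

theorem ends_mono {α β : Type*} (G : Graph α β) {X Y : Set β} (h : X ⊆ Y) :
    G.ends X ⊆ G.ends Y := fun _ ⟨e, he, hv⟩ ↦ ⟨e, h he, hv⟩

theorem ends_union {α β : Type*} (G : Graph α β) (X Y : Set β) :
    G.ends (X ∪ Y) = G.ends X ∪ G.ends Y := by
  ext v; simp only [ends, Set.mem_union, Set.mem_ofPred_eq]
  constructor
  · rintro ⟨e, he | he, hv⟩
    exacts [.inl ⟨e, he, hv⟩, .inr ⟨e, he, hv⟩]
  · rintro (⟨e, he, hv⟩ | ⟨e, he, hv⟩)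
    exacts [⟨e, .inl he, hv⟩, ⟨e, .inr he, hv⟩]

theorem vertexSet_edgeInduce {α β : Type*} (G : Graph α β) (X : Set β) :
    V(G.edgeInduce X) = G.ends X := rfl

theorem edgeInduce_isLink {α β : Type*} (G : Graph α β) (X : Set β) (e : β) (x y : α) :
    (G.edgeInduce X).IsLink e x y ↔ e ∈ X ∧ G.IsLink e x y := by
  simp only [edgeInduce, induce_isLink, restrict_isLink]
  exact ⟨fun h ↦ h.1, fun h ↦ ⟨h, ⟨e, h.1, h.2.inc_left⟩, ⟨e, h.1, h.2.inc_right⟩⟩⟩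

theorem edgeSet_edgeInduce {α β : Type*} (G : Graph α β) (X : Set β) :
    E(G.edgeInduce X) = E(G) ∩ X := by
  ext e
  rw [edge_mem_iff_exists_isLink, Set.mem_inter_iff, edge_mem_iff_exists_isLink]
  simp only [edgeInduce_isLink]
  grind

theorem edgeInduce_inc {α β : Type*} (G : Graph α β) (X : Set β) (e : β) (x : α) :
    (G.edgeInduce X).Inc e x ↔ e ∈ X ∧ G.Inc e x := by
  simp only [Inc, edgeInduce_isLink]; grind

/-- The number of edge-ends that the edges in `C` have at `v`. -/
noncomputable def degIn {α β : Type*} (G : Graph α β) (C : Finset β) (v : α) : ℕ :=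
  by classical exact (C.filter (G.Inc · v)).card + (C.filter (G.IsLoopAt · v)).card

/-- The number of ends that the edge `e` has in `W`. -/
noncomputable def endsIn {α β : Type*} (G : Graph α β) (W : Finset α) (e : β) : ℕ :=
  by classical exact (W.filter (G.Inc e ·)).card + (W.filter (G.IsLoopAt e ·)).card

theorem sum_degIn {α β : Type*} (G : Graph α β) (C : Finset β) (W : Finset α) :
    ∑ v ∈ W, G.degIn C v = ∑ e ∈ C, G.endsIn W e := by
  classical
  simp only [degIn, endsIn, Finset.sum_add_distrib, Finset.card_filter]
  rw [Finset.sum_comm]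
  congr 1
  rw [Finset.sum_comm]

theorem endsIn_le {α β : Type*} (G : Graph α β) (W : Finset α) (e : β) : G.endsIn W e ≤ 2 := by
  classical
  unfold endsIn
  by_cases he : e ∈ E(G)
  · obtain ⟨x, y, hxy⟩ := G.exists_isLink_of_mem_edgeSet he
    by_cases hne : x = y
    · subst hne
      have h1 : W.filter (G.Inc e ·) ⊆ {x} := fun v hv ↦ by
        simpa using Inc.eq_or_eq_of_isLink (Finset.mem_filter.1 hv).2 hxy
      have h2 : W.filter (G.IsLoopAt e ·) ⊆ {x} := fun v hv ↦ by
        simpa using Inc.eq_or_eq_of_isLink (Finset.mem_filter.1 hv).2.inc hxy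
      have := Finset.card_le_card h1
      have := Finset.card_le_card h2
      simp only [Finset.card_singleton] at *
      omega
    · have h1 : W.filter (G.Inc e ·) ⊆ {x, y} := fun v hv ↦ by
        simpa using Inc.eq_or_eq_of_isLink (Finset.mem_filter.1 hv).2 hxy
      have h2 : W.filter (G.IsLoopAt e ·) = ∅ := by
        refine Finset.filter_eq_empty_iff.2 fun v _ hl ↦ hne ?_
        rw [← hl.eq_of_inc hxy.inc_left, ← hl.eq_of_inc hxy.inc_right]
      have := Finset.card_le_card h1
      rw [Finset.card_pair hne] at this
      simp only [h2, Finset.card_empty]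
      omega
  · have h1 : W.filter (G.Inc e ·) = ∅ :=
      Finset.filter_eq_empty_iff.2 fun v _ hl ↦ he hl.edge_mem
    have h2 : W.filter (G.IsLoopAt e ·) = ∅ :=
      Finset.filter_eq_empty_iff.2 fun v _ hl ↦ he hl.edge_mem
    simp [h1, h2]

theorem endsIn_eq_zero {α β : Type*} (G : Graph α β) (W : Finset α) (e : β)
    (h : ∀ v ∈ W, ¬ G.Inc e v) : G.endsIn W e = 0 := by
  classical
  unfold endsIn
  have h1 : W.filter (G.Inc e ·) = ∅ :=
    Finset.filter_eq_empty_iff.2 fun v hv hl ↦ h v hv hl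
  have h2 : W.filter (G.IsLoopAt e ·) = ∅ :=
    Finset.filter_eq_empty_iff.2 fun v hv hl ↦ h v hv hl.inc
  simp [h1, h2]

theorem endsIn_eq_two_iff {α β : Type*} (G : Graph α β) (W : Finset α) {e : β} (he : e ∈ E(G)) :
    G.endsIn W e = 2 ↔ ∀ v, G.Inc e v → v ∈ W := by
  classical
  unfold endsIn
  obtain ⟨x, y, hxy⟩ := G.exists_isLink_of_mem_edgeSet he
  have hinc : ∀ v, G.Inc e v ↔ v = x ∨ v = y := fun v ↦
    ⟨fun h ↦ h.eq_or_eq_of_isLink hxy,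
      fun h ↦ by rcases h with rfl | rfl; exacts [hxy.inc_left, hxy.inc_right]⟩
  by_cases hne : x = y
  · subst hne
    have hloop : ∀ v, G.IsLoopAt e v ↔ v = x := fun v ↦
      ⟨fun h ↦ h.eq_of_inc hxy.inc_left, fun h ↦ h ▸ hxy⟩
    by_cases h : x ∈ W
    · have h1 : W.filter (G.Inc e ·) = {x} := by
        ext v; simp only [Finset.mem_filter, hinc, Finset.mem_singleton]; grind
      have h2 : W.filter (G.IsLoopAt e ·) = {x} := by
        ext v; simp only [Finset.mem_filter, hloop, Finset.mem_singleton]; grind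
      rw [h1, h2]; simp [hinc, h]
    · have h1 : W.filter (G.Inc e ·) = ∅ := by
        refine Finset.filter_eq_empty_iff.2 fun v hv hl ↦ h ?_
        rcases (hinc v).1 hl with rfl | rfl <;> exact hv
      have h2 : W.filter (G.IsLoopAt e ·) = ∅ :=
        Finset.filter_eq_empty_iff.2 fun v hv hl ↦ h ((hloop v).1 hl ▸ hv)
      rw [h1, h2]; simp [hinc, h]
  · have hloop : ∀ v, ¬ G.IsLoopAt e v := fun v hl ↦ hne <| by
      rw [← hl.eq_of_inc hxy.inc_left, ← hl.eq_of_inc hxy.inc_right]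
    simp only [hloop, Finset.filter_false, Finset.card_empty, add_zero, hinc]
    constructor
    · intro h v hv
      have hsub : W.filter (fun v ↦ v = x ∨ v = y) ⊆ {x, y} := fun v hv ↦ by
        simpa using (Finset.mem_filter.1 hv).2
      have heq := Finset.eq_of_subset_of_card_le hsub (by rw [Finset.card_pair hne, h])
      have : v ∈ ({x, y} : Finset α) := by simpa using hv
      rw [← heq] at this
      exact (Finset.mem_filter.1 this).1
    · intro h
      have : W.filter (fun v ↦ v = x ∨ v = y) = {x, y} := by
        ext v
        simp only [Finset.mem_filter, Finset.mem_insert, Finset.mem_singleton]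
        exact ⟨fun h ↦ h.2, fun hv ↦ ⟨h v hv, hv⟩⟩
      rw [this, Finset.card_pair hne]

theorem deg_edgeInduce {α β : Type*} (G : Graph α β) (C : Finset β) (v : α) :
    (G.edgeInduce C).deg v = G.degIn C v := by
  classical
  unfold deg degIn
  have h1 : (G.edgeInduce C).vertexStar v = (C.filter (G.Inc · v) : Finset β) := by
    ext e; simp [vertexStar, edgeInduce_inc]
  have h2 : {e | (G.edgeInduce C).IsLoopAt e v} = (C.filter (G.IsLoopAt · v) : Finset β) := by
    ext e; simp [← isLink_self_iff, edgeInduce_isLink]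
  rw [h1, h2, Set.encard_coe_eq_coe_finsetCard, Set.encard_coe_eq_coe_finsetCard]
  push_cast
  rfl

theorem excess_edgeInduce {α β : Type*} (G : Graph α β) (C : Finset β) (hC : (C : Set β) ⊆ E(G)) :
    (G.edgeInduce C).excess = (C.card : ℤ) - (G.ends C).ncard := by
  rw [excess, vertexSet_edgeInduce, edgeSet_edgeInduce, Set.inter_eq_right.2 hC,
    Set.ncard_coe_finset]

theorem deg_of_closed {α β : Type*} {G H : Graph α β} (h : H.IsClosedSubgraph G) {v : α}
    (hv : v ∈ V(H)) : H.deg v = G.deg v := by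
  unfold deg
  have h1 : H.vertexStar v = G.vertexStar v := by
    ext e; exact h.inc_congr hv
  have h2 : {e | H.IsLoopAt e v} = {e | G.IsLoopAt e v} := by
    ext e; exact h.isLink_congr hv
  rw [h1, h2]

/-- An edge set of excess at least `k` contains a `k`-circuit. -/
theorem exists_kCircuit_subset {α β : Type*} (G : Graph α β) {k : ℕ} (hk : 1 ≤ k) (C : Finset β)
    (hC : (C : Set β) ⊆ E(G)) (h : (G.ends C).ncard + k ≤ C.card) :
    ∃ D : Finset β, D ⊆ C ∧ (D : Set β) ∈ G.kCircuits k := by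
  classical
  induction hn : C.card using Nat.strong_induction_on generalizing C with
  | _ n ih =>
  by_cases hmin : ∃ D : Finset β, D ⊂ C ∧ (G.ends D).ncard + k ≤ D.card
  · obtain ⟨D, hDC, hD⟩ := hmin
    obtain ⟨D', hD', hD''⟩ := ih D.card (hn ▸ Finset.card_lt_card hDC) D
      (fun e he ↦ hC (hDC.1 he)) hD rfl
    exact ⟨D', hD'.trans hDC.1, hD''⟩
  push Not at hmin
  refine ⟨C, subset_rfl, hC, C.finite_toSet, ?_, ?_⟩
  · rw [excess_edgeInduce G C hC]
    have hne : C.Nonempty := by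
      rw [← Finset.card_pos]; omega
    obtain ⟨e, he⟩ := hne
    have h1 := hmin _ (Finset.erase_ssubset he)
    rw [Finset.card_erase_of_mem he] at h1
    have h2 : (G.ends (C.erase e : Finset β)).ncard ≤ (G.ends C).ncard :=
      Set.ncard_le_ncard (G.ends_mono (by simp)) (G.ends_finite C.finite_toSet)
    omega
  constructor
  · rintro x ⟨e, he, hx⟩ h0
    rw [deg_edgeInduce] at h0
    have h0' : G.degIn C x = 0 := by exact_mod_cast h0
    have h1 : e ∈ C.filter (G.Inc · x) := Finset.mem_filter.2 ⟨by simpa using he, hx⟩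
    have h2 : 0 < (C.filter (G.Inc · x)).card := Finset.card_pos.2 ⟨e, h1⟩
    unfold degIn at h0'
    omega
  · rintro x ⟨e, he, hx⟩ h0
    rw [deg_edgeInduce] at h0
    have h0' : G.degIn C x = 1 := by exact_mod_cast h0
    have he' : e ∈ C := by simpa using he
    have h1 : e ∈ C.filter (G.Inc · x) := Finset.mem_filter.2 ⟨he', hx⟩
    have h2 : 0 < (C.filter (G.Inc · x)).card := Finset.card_pos.2 ⟨e, h1⟩
    unfold degIn at h0'
    have h3 : (C.filter (G.Inc · x)).card = 1 := by omega
    have h4 := hmin _ (Finset.erase_ssubset he')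
    rw [Finset.card_erase_of_mem he'] at h4
    have h5 : G.ends (C.erase e : Finset β) ⊂ G.ends C := by
      refine (G.ends_mono (by simp)).ssubset_of_mem_notMem (a := x) ⟨e, he, hx⟩ ?_
      rintro ⟨f, hf, hfx⟩
      have hf' := Finset.mem_erase.1 (by simpa only [Finset.mem_coe] using hf)
      obtain ⟨g, hg⟩ := Finset.card_eq_one.1 h3
      have := hg ▸ Finset.mem_filter.2 ⟨hf'.2, hfx⟩
      have := hg ▸ h1
      simp_all
    have h6 := Set.ncard_lt_ncard h5 (G.ends_finite C.finite_toSet)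
    have : 0 < C.card := Finset.card_pos.2 ⟨e, he'⟩
    omega
  · rintro H ⟨hcl, -⟩ ⟨hfin, ⟨⟨x, hx⟩, -⟩, hdeg⟩
    set W : Finset α := hfin.toFinset with hW
    set F : Finset β := C.filter (· ∈ E(H)) with hF
    have hWends : (W : Set α) ⊆ G.ends C := by
      rw [hW, Set.Finite.coe_toFinset]
      exact hcl.le.vertexSet_mono
    have hdeg' : ∀ v ∈ W, G.degIn C v = 2 := fun v hv ↦ by
      have hv' : v ∈ V(H) := by simpa [hW] using hv
      have := hdeg v hv'
      rw [deg_of_closed hcl hv', deg_edgeInduce] at this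
      exact_mod_cast this
    have hincF : ∀ e ∈ C, ∀ v ∈ W, G.Inc e v → e ∈ F := fun e he v hv hev ↦ by
      refine Finset.mem_filter.2 ⟨he, hcl.closed (x := v) ?_ (by simpa [hW] using hv)⟩
      rw [edgeInduce_inc]
      exact ⟨by simpa using he, hev⟩
    have hsum := G.sum_degIn C W
    rw [Finset.sum_congr rfl hdeg', Finset.sum_const, smul_eq_mul,
      ← Finset.sum_filter_add_sum_filter_not C (· ∈ E(H))] at hsum
    have hF2 : ∑ e ∈ C with e ∈ E(H), G.endsIn W e = F.card * 2 := by
      rw [← smul_eq_mul, ← Finset.sum_const]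
      refine Finset.sum_congr rfl fun e he ↦ ?_
      obtain ⟨heC, heH⟩ := Finset.mem_filter.1 he
      rw [endsIn_eq_two_iff G W (hC heC)]
      intro v hv
      have hvH : H.Inc e v := by
        rw [hcl.le.inc_congr heH, edgeInduce_inc]
        exact ⟨heC, hv⟩
      simpa [hW] using hvH.vertex_mem
    have hF0 : ∑ e ∈ C with e ∉ E(H), G.endsIn W e = 0 := by
      refine Finset.sum_eq_zero fun e he ↦ G.endsIn_eq_zero W e fun v hv hev ↦ ?_
      obtain ⟨heC, heH⟩ := Finset.mem_filter.1 he
      exact heH (Finset.mem_filter.1 (hincF e heC v hv hev)).2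
    rw [hF2, hF0] at hsum
    have hFW : F.card = W.card := by omega
    have hWpos : 0 < W.card := Finset.card_pos.2 ⟨x, by simpa [hW] using hx⟩
    have hFC : F ⊆ C := Finset.filter_subset _ _
    have hss : C \ F ⊂ C := by
      refine Finset.sdiff_ssubset hFC (Finset.card_pos.1 (by omega))
    have h4 := hmin _ hss
    have h5 : G.ends (C \ F : Finset β) ⊆ G.ends C \ W := by
      rintro v ⟨e, he, hev⟩
      have he' := Finset.mem_sdiff.1 (by simpa only [Finset.mem_coe] using he)
      exact ⟨⟨e, by simpa using he'.1, hev⟩, fun hv ↦ he'.2 (hincF e he'.1 v hv hev)⟩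
    have h6 := Set.ncard_le_ncard h5 ((G.ends_finite C.finite_toSet).sdiff)
    have h7 := Set.ncard_sdiff_add_ncard_of_subset hWends (G.ends_finite C.finite_toSet)
    rw [Set.ncard_coe_finset] at h7
    have h8 := Finset.card_sdiff_add_card_eq_card hFC
    omega

/-- A proper subset of a `k`-circuit has excess less than `k`. -/
theorem kCircuit_ssubset {α β : Type*} (G : Graph α β) {k : ℕ} {C D : Finset β}
    (hC : (C : Set β) ∈ G.kCircuits k) (hDC : D ⊂ C) : D.card < (G.ends D).ncard + k := by
  classical
  obtain ⟨hCE, -, hex, hcac⟩ := hC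
  rw [excess_edgeInduce G C hCE] at hex
  by_contra! hcon
  have hends : G.ends D ⊆ G.ends C := G.ends_mono (by exact_mod_cast hDC.1)
  have hfin : (G.ends C \ G.ends D).Finite := (G.ends_finite C.finite_toSet).sdiff
  set W : Finset α := hfin.toFinset with hW
  have hmemW : ∀ v, v ∈ W ↔ v ∈ G.ends C ∧ v ∉ G.ends D := fun v ↦ by simp [hW]
  have hWcard : W.card + (G.ends D).ncard = (G.ends C).ncard := by
    rw [← Set.ncard_sdiff_add_ncard_of_subset hends (G.ends_finite C.finite_toSet), hW,
      Set.ncard_eq_toFinset_card _ hfin]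
  have hcd := Finset.card_sdiff_add_card_eq_card hDC.1
  have hpos : 0 < (C \ D).card := Finset.card_pos.2 (Finset.sdiff_nonempty.2 hDC.2)
  have hdeg2 : ∀ v ∈ W, 2 ≤ G.degIn C v := fun v hv ↦ by
    have hv' : v ∈ V(G.edgeInduce C) := ((hmemW v).1 hv).1
    have h0 := hcac.no_isolated v hv'
    have h1 := hcac.no_leaf v hv'
    rw [deg_edgeInduce] at h0 h1
    have h0' : G.degIn C v ≠ 0 := by exact_mod_cast h0
    have h1' : G.degIn C v ≠ 1 := by exact_mod_cast h1
    omega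
  have hzero : ∀ e ∈ D, G.endsIn W e = 0 := fun e he ↦
    G.endsIn_eq_zero W e fun v hv hev ↦ ((hmemW v).1 hv).2 ⟨e, by simpa using he, hev⟩
  have hsum := G.sum_degIn C W
  rw [← Finset.sum_sdiff hDC.1, Finset.sum_eq_zero hzero, add_zero] at hsum
  have hlow : W.card * 2 ≤ ∑ v ∈ W, G.degIn C v := by
    rw [← smul_eq_mul]; exact Finset.card_nsmul_le_sum _ _ _ hdeg2
  have hup : ∑ e ∈ C \ D, G.endsIn W e ≤ (C \ D).card * 2 := by
    rw [← smul_eq_mul]; exact Finset.sum_le_card_nsmul _ _ _ fun e _ ↦ G.endsIn_le W e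
  have heq : W.card = (C \ D).card := by omega
  have hdegeq : ∀ v ∈ W, G.degIn C v = 2 := by
    have : ∑ v ∈ W, 2 = ∑ v ∈ W, G.degIn C v := by
      rw [Finset.sum_const, smul_eq_mul]; omega
    exact fun v hv ↦ ((Finset.sum_eq_sum_iff_of_le hdeg2).1 this v hv).symm
  have hendeq : ∀ e ∈ C \ D, G.endsIn W e = 2 := by
    have : ∑ e ∈ C \ D, G.endsIn W e = ∑ e ∈ C \ D, 2 := by
      rw [Finset.sum_const, smul_eq_mul]; omega
    exact (Finset.sum_eq_sum_iff_of_le fun e _ ↦ G.endsIn_le W e).1 this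
  have hstay : ∀ e x y, (G.edgeInduce C).IsLink e x y → x ∈ W → y ∈ W := by
    intro e x y hl hx
    rw [edgeInduce_isLink] at hl
    have heC : e ∈ C := by simpa using hl.1
    have heD : e ∉ D := fun heD ↦ ((hmemW x).1 hx).2 ⟨e, by simpa using heD, hl.2.inc_left⟩
    exact (endsIn_eq_two_iff G W (hCE hl.1)).1 (hendeq e (Finset.mem_sdiff.2 ⟨heC, heD⟩)) y
      hl.2.inc_right
  obtain ⟨w, hw⟩ : W.Nonempty := Finset.card_pos.1 (by omega)
  set K := G.edgeInduce C with hK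
  set X : Set α := {v | Relation.ReflTransGen K.Adj w v} with hX
  have hXW : X ⊆ W := by
    intro v hv
    induction hv with
    | refl => exact hw
    | tail _ hadj ih =>
      obtain ⟨e, he⟩ := hadj
      exact hstay e _ _ he ih
  have hXK : X ⊆ V(K) := fun v hv ↦ ((hmemW v).1 (hXW hv)).1
  have hcl : (K.induce X).IsClosedSubgraph K := by
    refine IsClosedSubgraph.mk' (induce_le hXK) ?_
    rintro e x ⟨y, hxy⟩ hx
    have hx' : x ∈ X := hx
    exact ⟨x, y, hxy, hx', hx'.tail ⟨e, hxy⟩⟩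
  have hreach : ∀ v ∈ X, Relation.ReflTransGen (K.induce X).Adj w v := by
    intro v hv
    induction hv with
    | refl => exact .refl
    | tail hab hadj ih =>
      obtain ⟨e, he⟩ := hadj
      exact ih.tail ⟨e, he, hab, hab.tail ⟨e, he⟩⟩
  have hconn : (K.induce X).IsConnected := by
    refine ⟨⟨w, Relation.ReflTransGen.refl⟩, fun x hx y hy ↦ ?_⟩
    have hsymm : Relation.ReflTransGen (K.induce X).Adj x w :=
      Relation.ReflTransGen.stdSymm.symm _ _ (hreach x hx)
    exact hsymm.trans (hreach y hy)
  refine hcac.no_cycle_component _ ⟨hcl, hconn⟩ ⟨W.finite_toSet.subset hXW, hconn, fun v hv ↦ ?_⟩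
  rw [deg_of_closed hcl hv, deg_edgeInduce, hdegeq v (hXW hv)]
  rfl

/-- `I` is a finite set of edges of `G` that contains no `k`-circuit. -/
def kIndep {α β : Type*} (G : Graph α β) (k : ℕ) (I : Finset β) : Prop :=
  (I : Set β) ⊆ E(G) ∧ ∀ C ∈ G.kCircuits k, ¬ C ⊆ I

theorem kIndep_subset {α β : Type*} (G : Graph α β) (k : ℕ) ⦃I J : Finset β⦄
    (hJ : G.kIndep k J) (hIJ : I ⊆ J) : G.kIndep k I :=
  ⟨(Finset.coe_subset.2 hIJ).trans hJ.1,
    fun C hC hCI ↦ hJ.2 C hC (hCI.trans (Finset.coe_subset.2 hIJ))⟩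

theorem kIndep_iff {α β : Type*} (G : Graph α β) {k : ℕ} (hk : 1 ≤ k) (I : Finset β) :
    G.kIndep k I ↔ (I : Set β) ⊆ E(G) ∧ ∀ J ⊆ I, J.card < (G.ends J).ncard + k := by
  classical
  refine and_congr_right fun hI ↦ ⟨fun h J hJ ↦ ?_, fun h C hC hCI ↦ ?_⟩
  · by_contra! hcon
    obtain ⟨D, hDJ, hD⟩ := G.exists_kCircuit_subset hk J
      (fun e he ↦ hI (hJ (by simpa using he))) hcon
    exact h _ hD (by exact_mod_cast hDJ.trans hJ)
  · obtain ⟨hCE, hfin, hex, -⟩ := hC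
    lift C to Finset β using hfin
    rw [excess_edgeInduce G C hCE] at hex
    have := h C (by exact_mod_cast hCI)
    omega

theorem ends_ncard_submodular {α β : Type*} [DecidableEq β] (G : Graph α β) (S T : Finset β) :
    (G.ends (S ∪ T : Finset β)).ncard + (G.ends (S ∩ T : Finset β)).ncard ≤
      (G.ends S).ncard + (G.ends T).ncard := by
  rw [← Set.ncard_union_add_ncard_inter (G.ends S) (G.ends T) (G.ends_finite S.finite_toSet)
    (G.ends_finite T.finite_toSet), Finset.coe_union, ends_union]
  gcongr
  · exact (G.ends_finite S.finite_toSet).inter_of_left _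
  · exact Set.subset_inter (G.ends_mono (by simp)) (G.ends_mono (by simp))

theorem kIndep_empty {α β : Type*} (G : Graph α β) {k : ℕ} (hk : 1 ≤ k) : G.kIndep k ∅ :=
  (kIndep_iff G hk ∅).2 ⟨by simp, fun J hJ ↦ by
    rw [Finset.subset_empty.1 hJ, Finset.card_empty]; omega⟩

theorem kIndep_aug {α β : Type*} (G : Graph α β) {k : ℕ} (hk : 1 ≤ k) {I J : Finset β}
    [DecidableEq β] (hI : G.kIndep k I) (hJ : G.kIndep k J) (hIJ : I.card < J.card) :
    ∃ e ∈ J, e ∉ I ∧ G.kIndep k (insert e I) := by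
  rw [kIndep_iff G hk] at hI hJ
  simp only [kIndep_iff G hk]
  by_contra! hcon
  have key : ∀ e ∈ J, e ∉ I → ∃ T ⊆ I, (G.ends T).ncard + k = T.card + 1 ∧
      ∀ v, G.Inc e v → v ∈ G.ends T := by
    intro e heJ heI
    have hsub : ((insert e I : Finset β) : Set β) ⊆ E(G) := by
      rw [Finset.coe_insert]
      exact Set.insert_subset (hJ.1 (by simpa using heJ)) hI.1
    obtain ⟨Y, hY, hYc⟩ := hcon e heJ heI hsub
    have heY : e ∈ Y := by
      by_contra heY
      have := hI.2 Y ((Finset.subset_insert_iff_of_notMem heY).1 hY)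
      omega
    have hT : Y.erase e ⊆ I := Finset.subset_insert_iff.1 hY
    have h1 := hI.2 _ hT
    have hle : (G.ends (Y.erase e : Finset β)).ncard ≤ (G.ends Y).ncard :=
      Set.ncard_le_ncard (G.ends_mono (by simp)) (G.ends_finite Y.finite_toSet)
    have hcard := Finset.card_erase_add_one heY
    refine ⟨Y.erase e, hT, by omega, fun v hv ↦ ?_⟩
    have heq : G.ends (Y.erase e : Finset β) = G.ends Y :=
      Set.eq_of_subset_of_ncard_le (G.ends_mono (by simp)) (by omega)
        (G.ends_finite Y.finite_toSet)
    rw [heq]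
    exact ⟨e, by simpa using heY, hv⟩
  have hex : ∃ e ∈ J, e ∉ I := by
    by_contra! h
    have := Finset.card_le_card (show J ⊆ I from h)
    omega
  have hunion : ∀ A : Finset β, A ⊆ J \ I → A.Nonempty → ∃ T ⊆ I,
      (G.ends T).ncard + k = T.card + 1 ∧ ∀ e ∈ A, ∀ v, G.Inc e v → v ∈ G.ends T := by
    intro A hA hne
    induction hne using Finset.Nonempty.cons_induction with
    | singleton a =>
      have ha := Finset.mem_sdiff.1 (hA (Finset.mem_singleton_self a))
      obtain ⟨T, hT, h1, h2⟩ := key a ha.1 ha.2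
      exact ⟨T, hT, h1, by simpa using h2⟩
    | cons a s has hs ih =>
      rw [Finset.cons_eq_insert] at hA
      obtain ⟨S, hS, hS1, hS2⟩ := ih ((Finset.subset_insert _ _).trans hA)
      have ha := Finset.mem_sdiff.1 (hA (Finset.mem_insert_self a s))
      obtain ⟨T, hT, hT1, hT2⟩ := key a ha.1 ha.2
      refine ⟨S ∪ T, Finset.union_subset hS hT, ?_, ?_⟩
      · have h1 := G.ends_ncard_submodular S T
        have h2 := hI.2 _ (Finset.union_subset hS hT)
        have h3 := hI.2 (S ∩ T) (Finset.inter_subset_left.trans hS)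
        have h4 := Finset.card_union_add_card_inter S T
        omega
      · intro e he v hv
        rw [Finset.coe_union, ends_union]
        rcases Finset.mem_cons.1 he with rfl | he
        · exact .inr (hT2 v hv)
        · exact .inl (hS2 e he v hv)
  obtain ⟨e₀, he₀J, he₀I⟩ := hex
  obtain ⟨T, hTI, hT, hTe⟩ := hunion (J \ I) subset_rfl ⟨e₀, Finset.mem_sdiff.2 ⟨he₀J, he₀I⟩⟩
  have h1 := hJ.2 ((J \ I) ∪ (J ∩ T))
    (Finset.union_subset Finset.sdiff_subset Finset.inter_subset_left)
  have h2 : G.ends ((J \ I) ∪ (J ∩ T) : Finset β) ⊆ G.ends T := by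
    rw [Finset.coe_union, ends_union]
    refine Set.union_subset ?_ (G.ends_mono (by simp))
    rintro v ⟨e, he, hv⟩
    exact hTe e (by simpa only [Finset.mem_coe] using he) v hv
  have h3 := Set.ncard_le_ncard h2 (G.ends_finite T.finite_toSet)
  have h4 : J ⊆ ((J \ I) ∪ (J ∩ T)) ∪ (I \ T) := fun e he ↦ by
    simp only [Finset.mem_union, Finset.mem_sdiff, Finset.mem_inter]; tauto
  have h5 := (Finset.card_le_card h4).trans (Finset.card_union_le _ _)
  have h6 := Finset.card_sdiff_add_card_eq_card hTI
  omega

open Classical in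
/-- The `k`-circular matroid `M_k(G)`, for `k ≥ 1`: the matroid on `E(G)` whose circuits are
the members of `C_k(G)`. -/
noncomputable def kCircularMatroid {α β : Type*} (G : Graph α β) (k : ℕ) (hk : 1 ≤ k) :
    Matroid β :=
  (IndepMatroid.ofFinset E(G) (G.kIndep k)
    (kIndep_empty G hk)
    (kIndep_subset G k)
    (fun _ _ hI hJ hIJ ↦ kIndep_aug G hk hI hJ hIJ)
    (fun _ hI ↦ hI.1)).matroid

theorem kCircularMatroid_ground {α β : Type*} (G : Graph α β) (k : ℕ) (hk : 1 ≤ k) :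
    (G.kCircularMatroid k hk).E = E(G) := rfl

theorem kCircularMatroid_indep_iff {α β : Type*} (G : Graph α β) (k : ℕ) (hk : 1 ≤ k)
    (I : Set β) : (G.kCircularMatroid k hk).Indep I ↔
      I ⊆ E(G) ∧ ∀ C ∈ G.kCircuits k, ¬ C ⊆ I := by
  classical
  have h0 : (G.kCircularMatroid k hk).Indep I ↔
      ∀ J : Finset β, (J : Set β) ⊆ I → G.kIndep k J :=
    IndepMatroid.ofFinset_indep' E(G) (G.kIndep k) (kIndep_empty G hk) (kIndep_subset G k)
      (fun _ _ hI hJ hIJ ↦ kIndep_aug G hk hI hJ hIJ) (fun _ hI ↦ hI.1)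
  rw [h0]
  constructor
  · refine fun h ↦ ⟨fun e he ↦ ?_, fun C hC hCI ↦ ?_⟩
    · exact (h {e} (by simpa using he)).1 (by simp)
    · obtain ⟨D, rfl⟩ := hC.2.1.exists_finset_coe
      exact (h D hCI).2 _ hC subset_rfl
  · exact fun h J hJ ↦ ⟨hJ.trans h.1, fun C hC hCJ ↦ h.2 C hC (hCJ.trans hJ)⟩

theorem kCircularMatroid_isCircuit_iff {α β : Type*} (G : Graph α β) (k : ℕ) (hk : 1 ≤ k)
    (C : Set β) : (G.kCircularMatroid k hk).IsCircuit C ↔ C ∈ G.kCircuits k := by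
  classical
  have hanti : ∀ C ∈ G.kCircuits k, ∀ D ∈ G.kCircuits k, D ⊆ C → D = C := by
    intro C hC D hD hDC
    obtain ⟨C, rfl⟩ := hC.2.1.exists_finset_coe
    obtain ⟨D, rfl⟩ := hD.2.1.exists_finset_coe
    by_contra hne
    have h1 := G.kCircuit_ssubset hC
      (Finset.ssubset_iff_subset_ne.2 ⟨by exact_mod_cast hDC, fun h ↦ hne (by rw [h])⟩)
    have h2 := hD.2.2.1
    rw [excess_edgeInduce G D hD.1] at h2
    omega
  rw [Matroid.isCircuit_iff]
  simp only [Matroid.dep_iff, kCircularMatroid_indep_iff, kCircularMatroid_ground]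
  constructor
  · rintro ⟨⟨h, hCE⟩, hmin⟩
    have h' : ∃ D ∈ G.kCircuits k, D ⊆ C := by
      by_contra! hcon
      exact h ⟨hCE, hcon⟩
    obtain ⟨D, hD, hDC⟩ := h'
    rwa [← hmin ⟨fun h ↦ h.2 D hD subset_rfl, hD.1⟩ hDC]
  · refine fun hC ↦ ⟨⟨fun h ↦ h.2 C hC subset_rfl, hC.1⟩, fun D hD hDC ↦ ?_⟩
    have h' : ∃ D' ∈ G.kCircuits k, D' ⊆ D := by
      by_contra! hcon
      exact hD.1 ⟨hD.2, hcon⟩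
    obtain ⟨D', hD', hDD'⟩ := h'
    exact hDC.antisymm (hanti C hC D' hD' (hDD'.trans hDC) ▸ hDD')

end Graph

/-!
An independent set `I` of `M_k(G)` satisfies `|I| + 1 ≤ |V(G⟨I⟩)| + k`, and its subsets attaining
this bound are closed under unions. Hence a nonempty cyclic set `X` (a union of circuits) has rank
`|V(G⟨X⟩)| + k - 1`, and its closure consists of all the edges with both ends in `V(G⟨X⟩)`. When
`G - x` is 2-edge-connected, the bound on `s(x, G)` makes `E(G) \ S(x, G)` cyclic, with
`|V(G)| - 1` end vertices. Cyclicity, rank and closure are read off the matroid, so in `G'` the same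
set misses exactly one vertex `x'`, and comparing closures gives `S(x', G') = S(x, G)`. As `G` and
`G'` have equally many vertices and the stars of `G` are distinct, every star of `G'` arises exactly
once.
-/

namespace KCircular

open Set Graph

variable {α α' β : Type*} {G H : Graph α β} {G' : Graph α' β} {e : β} {X S T I C : Set β}
  {k n : ℕ} {hk : 1 ≤ k} {x : α}

theorem ends_subset_vertexSet (G : Graph α β) (X : Set β) : G.ends X ⊆ V(G) :=
  fun _ ⟨_, _, hv⟩ ↦ hv.vertex_mem

theorem ends_nonempty (hX : X ⊆ E(G)) (hne : X.Nonempty) : (G.ends X).Nonempty := by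
  obtain ⟨e, he⟩ := hne
  obtain ⟨x, y, hxy⟩ := G.exists_isLink_of_mem_edgeSet (hX he)
  exact ⟨x, e, he, hxy.inc_left⟩

theorem ends_singleton_subset_iff {W : Set α} :
    G.ends {e} ⊆ W ↔ ∀ v, G.Inc e v → v ∈ W := by
  simp [ends, subset_def]

theorem ends_singleton_subset (he : e ∈ X) : G.ends {e} ⊆ G.ends X :=
  G.ends_mono (singleton_subset_iff.2 he)

theorem ends_subset_iff {W : Set α} : G.ends X ⊆ W ↔ ∀ e ∈ X, G.ends {e} ⊆ W :=
  ⟨fun h _ he ↦ (ends_singleton_subset he).trans h,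
    fun h _ ⟨e, he, hv⟩ ↦ h e he ⟨e, rfl, hv⟩⟩

theorem ends_eq_of_le (h : H ≤ G) (hX : X ⊆ E(H)) : H.ends X = G.ends X := by
  ext v
  exact exists_congr fun e ↦ and_congr_right fun he ↦ h.inc_congr (hX he)

theorem ends_edgeSet (h : ∀ x ∈ V(G), (G.vertexStar x).Nonempty) : G.ends E(G) = V(G) :=
  (ends_subset_vertexSet G _).antisymm fun x hx ↦
    let ⟨e, he⟩ := h x hx
    ⟨e, he.edge_mem, he⟩

theorem encard_ends_union_add_encard_ends_inter_le (G : Graph α β) (S T : Set β) :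
    (G.ends (S ∪ T)).encard + (G.ends (S ∩ T)).encard ≤ (G.ends S).encard + (G.ends T).encard := by
  rw [← encard_union_add_encard_inter (G.ends S), ends_union]
  gcongr
  exact subset_inter (G.ends_mono inter_subset_left) (G.ends_mono inter_subset_right)

theorem encard_add_one_le_of_indep (hI : (G.kCircularMatroid k hk).Indep I) :
    I.encard + 1 ≤ (G.ends I).encard + k := by
  by_contra! hlt
  obtain ⟨J, hJI, hJ⟩ := exists_subset_encard_eq (Order.le_of_lt_add_one hlt)
  have hfin : J.Finite := encard_lt_top_iff.1 (hJ ▸ hlt.trans_le le_top)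
  lift J to Finset β using hfin
  have hlt' := ((kIndep_iff G hk J).1
    ((kCircularMatroid_indep_iff G k hk J).1 (hI.subset hJI))).2 J subset_rfl
  have hle : (J.card : ℕ∞) < J.card := calc
    (J.card : ℕ∞) < ((G.ends J).ncard + k : ℕ) := by exact_mod_cast hlt'
    _ = (G.ends J).encard + k := by
      rw [Nat.cast_add, (G.ends_finite J.finite_toSet).cast_ncard_eq]
    _ ≤ (G.ends I).encard + k := by gcongr; exact G.ends_mono hJI
    _ = J.card := by rw [← hJ, encard_coe_eq_coe_finsetCard]
  exact hle.false

theorem encard_eq_of_isCircuit (hC : (G.kCircularMatroid k hk).IsCircuit C) :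
    C.encard = (G.ends C).encard + k := by
  obtain ⟨hCE, hfin, hexcess, -⟩ := (G.kCircularMatroid_isCircuit_iff k hk C).1 hC
  lift C to Finset β using hfin
  rw [excess_edgeInduce G C hCE] at hexcess
  rw [← (G.ends_finite C.finite_toSet).cast_ncard_eq, encard_coe_eq_coe_finsetCard]
  norm_cast
  lia

theorem ends_sdiff_singleton_of_isCircuit (hC : (G.kCircularMatroid k hk).IsCircuit C)
    (he : e ∈ C) : G.ends (C \ {e}) = G.ends C := by
  have hfin : C.Finite := ((G.kCircularMatroid_isCircuit_iff k hk C).1 hC).2.1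
  refine (G.ends_finite hfin).eq_of_subset_of_encard_le'
    (G.ends_mono sdiff_subset) ?_
  have hle := encard_add_one_le_of_indep (hC.sdiff_singleton_indep he)
  rw [encard_sdiff_singleton_add_one he, encard_eq_of_isCircuit hC] at hle
  exact (ENat.add_le_add_iff_right (ENat.natCast_ne_top k)).1 hle

theorem ends_closure (hX : X ⊆ E(G)) :
    G.ends ((G.kCircularMatroid k hk).closure X) = G.ends X := by
  refine (ends_subset_iff.2 fun e he ↦ ?_).antisymm
    (G.ends_mono ((G.kCircularMatroid k hk).subset_closure X hX))
  by_cases heX : e ∈ X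
  · exact ends_singleton_subset heX
  obtain ⟨C, hCX, hC, heC⟩ := Matroid.exists_isCircuit_of_mem_closure he heX
  calc G.ends {e} ⊆ G.ends C := ends_singleton_subset heC
    _ = G.ends (C \ {e}) := (ends_sdiff_singleton_of_isCircuit hC heC).symm
    _ ⊆ G.ends X := G.ends_mono (by simpa [insert_comm] using hCX)

/-- A set `T` of edges is tight if it attains the bound `|T| + 1 ≤ |V(G⟨T⟩)| + k`, which holds for
all independent sets of the `k`-circular matroid. The equation avoids subtraction. -/
def IsTight (G : Graph α β) (k : ℕ) (T : Set β) : Prop :=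
  T.encard + 1 = (G.ends T).encard + k

theorem isTight_sdiff_singleton_of_isCircuit (hC : (G.kCircularMatroid k hk).IsCircuit C)
    (he : e ∈ C) : IsTight G k (C \ {e}) := by
  rw [IsTight, encard_sdiff_singleton_add_one he, ends_sdiff_singleton_of_isCircuit hC he,
    encard_eq_of_isCircuit hC]

theorem IsTight.union (hI : (G.kCircularMatroid k hk).Indep I) (hfin : I.Finite) (hSI : S ⊆ I)
    (hTI : T ⊆ I) (hS : IsTight G k S) (hT : IsTight G k T) : IsTight G k (S ∪ T) := by
  have hunion := encard_add_one_le_of_indep (hI.subset (union_subset hSI hTI))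
  have hinter := encard_add_one_le_of_indep (hI.subset (inter_subset_left.trans hSI : S ∩ T ⊆ I))
  have hcard := encard_union_add_encard_inter S T
  have hends := encard_ends_union_add_encard_ends_inter_le G S T
  have hSfin := hfin.subset hSI
  have hTfin := hfin.subset hTI
  simp only [IsTight, ← (hSfin.union hTfin).cast_ncard_eq, ← hSfin.cast_ncard_eq,
    ← hTfin.cast_ncard_eq, ← (hSfin.inter_of_left T).cast_ncard_eq,
    ← (G.ends_finite (hSfin.union hTfin)).cast_ncard_eq,
    ← (G.ends_finite hSfin).cast_ncard_eq, ← (G.ends_finite hTfin).cast_ncard_eq,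
    ← (G.ends_finite (hSfin.inter_of_left T)).cast_ncard_eq] at hunion hinter hcard hends hS hT ⊢
  norm_cast at hunion hinter hcard hends hS hT ⊢
  lia

theorem IsTight.closure_eq (hT : IsTight G k T) (hI : (G.kCircularMatroid k hk).Indep T)
    (hfin : T.Finite) :
    (G.kCircularMatroid k hk).closure T = {e ∈ E(G) | G.ends {e} ⊆ G.ends T} := by
  refine Subset.antisymm (fun e he ↦ ⟨Matroid.mem_ground_of_mem_closure he, ?_⟩)
    fun e ⟨heE, he⟩ ↦ ?_
  · rw [← ends_closure (hk := hk) hI.subset_ground]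
    exact ends_singleton_subset he
  by_contra hecl
  have heT : e ∉ T := fun h ↦ hecl (Matroid.mem_closure_of_mem _ h hI.subset_ground)
  have hins := encard_add_one_le_of_indep ((hI.notMem_closure_iff_of_notMem heT heE).1 hecl)
  rw [insert_eq, ends_union, union_eq_self_of_subset_left he, ← insert_eq,
    encard_insert_of_notMem heT, ← hT] at hins
  exact (ENat.lt_add_one_iff (by simpa using hfin)).2 le_rfl |>.not_ge hins

theorem exists_isTight_subset (hI : (G.kCircularMatroid k hk).Indep I) (hfin : I.Finite)
    (hX : X ⊆ (G.kCircularMatroid k hk).closure I) (hXI : (X \ I).Nonempty) :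
    ∃ T ⊆ I, IsTight G k T ∧ X \ I ⊆ (G.kCircularMatroid k hk).closure T := by
  have hspan : ∀ e ∈ X \ I, ∃ T ⊆ I, IsTight G k T ∧ e ∈ (G.kCircularMatroid k hk).closure T := by
    rintro e ⟨heX, heI⟩
    obtain ⟨C, hCI, hC, heC⟩ := Matroid.exists_isCircuit_of_mem_closure (hX heX) heI
    exact ⟨C \ {e}, sdiff_singleton_subset_iff.2 hCI, isTight_sdiff_singleton_of_isCircuit hC heC,
      hC.mem_closure_sdiff_singleton_of_mem heC⟩
  obtain ⟨e₀, he₀⟩ := hXI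
  obtain ⟨T₀, hT₀I, hT₀, -⟩ := hspan e₀ he₀
  -- A maximal tight subset contains all the others, by `IsTight.union`.
  obtain ⟨T, ⟨hTI, hT⟩, hmax⟩ :=
    (hfin.finite_subsets.subset fun _ h ↦ h.1 : {T | T ⊆ I ∧ IsTight G k T}.Finite).exists_maximal
      ⟨T₀, hT₀I, hT₀⟩
  refine ⟨T, hTI, hT, fun e he ↦ ?_⟩
  obtain ⟨S, hSI, hS, heS⟩ := hspan e he
  have hST : S ∪ T ⊆ T :=
    hmax ⟨union_subset hSI hTI, hS.union hI hfin hSI hTI hT⟩ subset_union_right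
  exact Matroid.closure_subset_closure _ (subset_union_left.trans hST) heS

/-- A cyclic set of a matroid, that is, a union of circuits: each of its elements is spanned by the
others. -/
def IsCyclicSet (M : Matroid β) (X : Set β) : Prop :=
  ∀ e ∈ X, e ∈ M.closure (X \ {e})

theorem IsCyclicSet.subset_ground {M : Matroid β} (hX : IsCyclicSet M X) : X ⊆ M.E :=
  fun e he ↦ M.mem_ground_of_mem_closure (hX e he)

theorem IsCyclicSet.isTight_of_isBasis (hX : IsCyclicSet (G.kCircularMatroid k hk) X)
    (hne : X.Nonempty) (hI : (G.kCircularMatroid k hk).IsBasis I X) (hfin : I.Finite) :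
    IsTight G k I := by
  have hXI : (X \ I).Nonempty := by
    rw [sdiff_nonempty]
    intro hXI
    obtain ⟨e, he⟩ := hne
    exact (hI.indep.subset hXI).notMem_closure_sdiff_of_mem he (hX e he)
  obtain ⟨T, hTI, hT, hspan⟩ := exists_isTight_subset hI.indep hfin hI.subset_closure hXI
  suffices I ⊆ T from hTI.antisymm this ▸ hT
  intro t ht
  by_contra htT
  have hXt : X \ {t} ⊆ (G.kCircularMatroid k hk).closure (I \ {t}) := by
    rintro e ⟨heX, het⟩
    by_cases heI : e ∈ I
    · exact Matroid.mem_closure_of_mem' _ ⟨heI, het⟩ (hI.subset_ground heX)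
    · exact Matroid.closure_subset_closure _ (subset_sdiff_singleton hTI htT) (hspan ⟨heX, heI⟩)
  exact hI.indep.notMem_closure_sdiff_of_mem ht
    (Matroid.closure_subset_closure_of_subset_closure hXt (hX t (hI.subset ht)))

theorem ends_eq_of_isBasis (hI : (G.kCircularMatroid k hk).IsBasis I X) : G.ends I = G.ends X := by
  rw [← ends_closure (hk := hk) hI.indep.subset_ground, hI.closure_eq_closure,
    ends_closure hI.subset_ground]

theorem IsCyclicSet.eRk_add_one (hX : IsCyclicSet (G.kCircularMatroid k hk) X) (hne : X.Nonempty)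
    (hfin : X.Finite) : (G.kCircularMatroid k hk).eRk X + 1 = (G.ends X).encard + k := by
  obtain ⟨I, hI⟩ := (G.kCircularMatroid k hk).exists_isBasis X hX.subset_ground
  rw [hI.eRk_eq_encard, hX.isTight_of_isBasis hne hI (hfin.subset hI.subset), ends_eq_of_isBasis hI]

theorem IsCyclicSet.closure_eq (hX : IsCyclicSet (G.kCircularMatroid k hk) X) (hne : X.Nonempty)
    (hfin : X.Finite) :
    (G.kCircularMatroid k hk).closure X = {e ∈ E(G) | G.ends {e} ⊆ G.ends X} := by
  obtain ⟨I, hI⟩ := (G.kCircularMatroid k hk).exists_isBasis X hX.subset_ground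
  have hIfin := hfin.subset hI.subset
  rw [← hI.closure_eq_closure, (hX.isTight_of_isBasis hne hI hIfin).closure_eq hI.indep hIfin,
    ends_eq_of_isBasis hI]

theorem exists_isLink_of_mem_of_notMem (hG : G.IsConnected) {W : Set α} {x y : α}
    (hx : x ∈ V(G)) (hxW : x ∈ W) (hy : y ∈ V(G)) (hyW : y ∉ W) :
    ∃ e u v, G.IsLink e u v ∧ u ∈ W ∧ v ∉ W := by
  by_contra! hclosed
  have hreach : ∀ z, Relation.ReflTransGen G.Adj x z → z ∈ W := fun z hz ↦ by
    induction hz with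
    | refl => exact hxW
    | tail _ hadj ih => exact let ⟨e, he⟩ := hadj; hclosed e _ _ he ih
  exact hyW (hreach y (hG.2 x hx y hy))

theorem vertexStar_nonempty_of_isConnected (hG : G.IsConnected) (hV : V(G).Nontrivial)
    (hx : x ∈ V(G)) : (G.vertexStar x).Nonempty := by
  obtain ⟨y, hy, hyx⟩ := hV.exists_ne x
  obtain ⟨e, u, v, he, rfl, -⟩ :=
    exists_isLink_of_mem_of_notMem hG hx (mem_singleton x) hy hyx
  exact ⟨e, he.inc_left⟩

theorem encard_sdiff_le_of_isConnected (hG : G.IsConnected) {W : Set α} (hWV : W ⊆ V(G))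
    (hW : W.Nonempty) : (V(G) \ W).encard ≤ {e ∈ E(G) | ¬ G.ends {e} ⊆ W}.encard := by
  refine ENat.forall_natCast_le_iff_le.1 fun n hn ↦ ?_
  induction n generalizing W with
  | zero => simp
  | succ n ih =>
    obtain ⟨x, hxV, hxW⟩ : (V(G) \ W).Nonempty := by
      rw [← encard_pos]
      exact (ENat.natCast_lt_natCast.2 n.succ_pos).trans_le hn
    obtain ⟨w, hw⟩ := hW
    obtain ⟨e, u, v, he, hu, hv⟩ := exists_isLink_of_mem_of_notMem hG (hWV hw) hw hxV hxW
    have hcount : (n : ℕ∞) ≤ (V(G) \ insert v W).encard := by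
      rwa [← ENat.add_le_add_iff_right ENat.one_ne_top, insert_eq, union_comm, ← sdiff_sdiff,
        encard_sdiff_singleton_add_one (mem_sdiff_of_mem he.right_mem hv), ← Nat.cast_succ]
    have heW : e ∈ {e ∈ E(G) | ¬ G.ends {e} ⊆ W} :=
      ⟨he.edge_mem, fun h ↦ hv (ends_singleton_subset_iff.1 h v he.inc_right)⟩
    have hsub : {e ∈ E(G) | ¬ G.ends {e} ⊆ insert v W} ⊆ {e ∈ E(G) | ¬ G.ends {e} ⊆ W} \ {e} := by
      rintro f ⟨hf, hfv⟩
      refine ⟨⟨hf, fun h ↦ hfv (h.trans (subset_insert v W))⟩, ?_⟩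
      rintro rfl
      refine hfv (ends_singleton_subset_iff.2 fun z hz ↦ ?_)
      obtain rfl | rfl := hz.eq_or_eq_of_isLink he
      exacts [mem_insert_of_mem v hu, mem_insert z W]
    calc ((n + 1 : ℕ) : ℕ∞) = n + 1 := Nat.cast_succ n
      _ ≤ ({e ∈ E(G) | ¬ G.ends {e} ⊆ W} \ {e}).encard + 1 := by
        gcongr
        exact (ih (insert_subset he.right_mem hWV) (insert_nonempty v W) hcount).trans
          (encard_le_encard hsub)
      _ = _ := encard_sdiff_singleton_add_one heW

theorem eRk_add_one_of_isConnected (hH : H ≤ G) (hconn : H.IsConnected) (hfin : E(H).Finite)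
    (hdep : (G.kCircularMatroid k hk).Dep E(H)) :
    (G.kCircularMatroid k hk).eRk E(H) + 1 = V(H).encard + k := by
  obtain ⟨B, hB⟩ := (G.kCircularMatroid k hk).exists_isBasis E(H) hdep.subset_ground
  have hBE : (E(H) \ B).Nonempty := sdiff_nonempty.2 fun h ↦ hdep.not_indep (hB.indep.subset h)
  rw [hB.eRk_eq_encard]
  refine le_antisymm ((encard_add_one_le_of_indep hB.indep).trans ?_) ?_
  · gcongr
    rw [← ends_eq_of_le hH hB.subset]
    exact ends_subset_vertexSet H B
  obtain ⟨T, hTB, hT, hspan⟩ :=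
    exists_isTight_subset hB.indep (hfin.subset hB.subset) hB.subset_closure hBE
  have hTE := hTB.trans hB.subset
  have hTcl := hT.closure_eq (hB.indep.subset hTB) (hfin.subset hTE)
  have hTne : (H.ends T).Nonempty := by
    obtain ⟨e, he⟩ := hBE
    have := hspan he
    rw [hTcl] at this
    rw [ends_eq_of_le hH hTE]
    exact (ends_nonempty (singleton_subset_iff.2 this.1) (singleton_nonempty e)).mono this.2
  -- An edge of `H` with an end outside `ends T` is not spanned by `T`, hence lies in `B`.
  have hsub : {e ∈ E(H) | ¬ H.ends {e} ⊆ H.ends T} ⊆ B \ T := by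
    rintro e ⟨heE, he⟩
    rw [ends_eq_of_le hH hTE, ends_eq_of_le hH (singleton_subset_iff.2 heE)] at he
    refine ⟨by_contra fun heB ↦ he ?_, fun heT ↦ he (ends_singleton_subset heT)⟩
    have := hspan ⟨heE, heB⟩
    rw [hTcl] at this
    exact this.2
  calc V(H).encard + k = (V(H) \ H.ends T).encard + ((H.ends T).encard + k) := by
        rw [← add_assoc, encard_sdiff_add_encard_of_subset (ends_subset_vertexSet H T)]
    _ ≤ (B \ T).encard + (T.encard + 1) := by
        rw [hT, ← ends_eq_of_le hH hTE]
        gcongr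
        exact (encard_sdiff_le_of_isConnected hconn (ends_subset_vertexSet H T) hTne).trans
          (encard_le_encard hsub)
    _ = B.encard + 1 := by rw [← add_assoc, encard_sdiff_add_encard_of_subset hTB]

/-- A graph is `n`-edge-connected if it is connected after the deletion of any set of fewer than `n`
edges. -/
def IsNEdgeConnected (G : Graph α β) (n : ℕ) : Prop :=
  ∀ F ⊆ E(G), F.encard < n → (G.deleteEdges F).IsConnected

theorem IsNEdgeConnected.isConnected (hG : IsNEdgeConnected G n) (hn : 1 ≤ n) : G.IsConnected := by
  simpa using hG ∅ (empty_subset _) (by simpa)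

theorem isCyclicSet_of_isNEdgeConnected_two (hH : H ≤ G) (hconn : IsNEdgeConnected H 2)
    (hfin : E(H).Finite) (hdep : (G.kCircularMatroid k hk).Dep E(H)) :
    IsCyclicSet (G.kCircularMatroid k hk) E(H) := by
  intro e he
  by_contra hecl
  have heins : insert e (E(H) \ {e}) = E(H) := insert_sdiff_self_of_mem he
  have hdep' : (G.kCircularMatroid k hk).Dep (E(H) \ {e}) := by
    rw [← Matroid.not_indep_iff (sdiff_subset.trans hdep.subset_ground)]
    intro hind
    refine hdep.not_indep ?_
    rw [← heins]
    exact (hind.notMem_closure_iff_of_notMem (by simp) (hdep.subset_ground he)).1 hecl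
  -- The rank formula gives `E(H)` and `E(H) \ {e}` the same rank.
  have hrank := eRk_add_one_of_isConnected hH (hconn.isConnected one_le_two) hfin hdep
  have hrank' := eRk_add_one_of_isConnected (deleteEdges_le.trans hH)
    (hconn {e} (singleton_subset_iff.2 he) (by simp)) (hfin.subset sdiff_subset) hdep'
  rw [vertexSet_deleteEdges, ← hrank] at hrank'
  have hins := Matroid.eRk_insert_eq_add_one ⟨hdep.subset_ground he, hecl⟩
  have hlt : (G.kCircularMatroid k hk).eRk E(H) < ⊤ :=
    (Matroid.eRk_le_encard _ _).trans_lt hfin.encard_lt_top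
  rw [heins, ← edgeSet_deleteEdges, hrank'] at hins
  exact (ENat.lt_add_one_iff hlt.ne).2 le_rfl |>.ne hins

/-! ### Connectivity -/

theorem exists_mem_notMem_of_encard_lt_encard {s t : Set α} (h : s.encard < t.encard) :
    ∃ x ∈ t, x ∉ s :=
  not_subset.1 fun hts ↦ (encard_le_encard hts).not_gt h

theorem deleteVerts_deleteVerts (G : Graph α β) (X Y : Set α) :
    (G.deleteVerts X).deleteVerts Y = G.deleteVerts (X ∪ Y) :=
  Graph.ext (by simp [sdiff_sdiff]) (by simp only [deleteVerts_isLink, mem_union, not_or]; grind)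

theorem isNConnected_deleteVerts_singleton (hG : G.IsNConnected (n + 1)) (hx : x ∈ V(G)) :
    (G.deleteVerts {x}).IsNConnected n := by
  refine ⟨?_, fun X hX hXn ↦ ?_⟩
  · rw [vertexSet_deleteVerts, ← ENat.add_lt_add_iff_right ENat.one_ne_top,
      encard_sdiff_singleton_add_one hx]
    exact_mod_cast hG.1
  · rw [vertexSet_deleteVerts] at hX
    rw [deleteVerts_deleteVerts, ← insert_eq]
    refine hG.2 _ (insert_subset hx (hX.trans sdiff_subset)) ((encard_insert_le X x).trans_lt ?_)
    exact_mod_cast (ENat.add_lt_add_iff_right ENat.one_ne_top).2 hXn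

theorem deleteVerts_insert_le {z : α} (hez : G.Inc e z) (X : Set α) :
    G.deleteVerts (insert z X) ≤ (G.deleteEdges {e}).deleteVerts X where
  vertexSet_mono := by simpa using sdiff_subset_sdiff_right (subset_insert z X)
  isLink_mono f a b hf := by
    simp only [deleteVerts_isLink, mem_insert_iff, not_or] at hf
    have hfe : f ≠ e := by
      rintro rfl
      obtain rfl | rfl := hez.eq_or_eq_of_isLink hf.1
      exacts [hf.2.1.1 rfl, hf.2.2.1 rfl]
    simp [hf, hfe]

theorem reflTransGen_adj_deleteEdges {z a b : α} {X : Set α} (hez : G.Inc e z)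
    (hconn : (G.deleteVerts (insert z X)).IsConnected) (ha : a ∈ V(G) \ insert z X)
    (hb : b ∈ V(G) \ insert z X) :
    Relation.ReflTransGen ((G.deleteEdges {e}).deleteVerts X).Adj a b :=
  Relation.ReflTransGen.mono (fun _ _ ↦ Adj.mono (deleteVerts_insert_le hez X)) _ _
    (hconn.2 a (by simpa using ha) b (by simpa using hb))

theorem isNConnected_deleteEdges_singleton (hG : G.IsNConnected (n + 1)) (e : β) :
    (G.deleteEdges {e}).IsNConnected n := by
  have hlt : (n : ℕ∞) < (n + 1 : ℕ) := ENat.natCast_lt_natCast.2 n.lt_succ_self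
  refine ⟨hlt.trans hG.1, fun X hXV hX ↦ ?_⟩
  rw [vertexSet_deleteEdges] at hXV
  have hins : ∀ z, (insert z X).encard < (n + 1 : ℕ) := fun z ↦
    (encard_insert_le X z).trans_lt ((ENat.add_lt_add_iff_right ENat.one_ne_top).2 hX)
  have hconn : (G.deleteVerts X).IsConnected := hG.2 X hXV (hX.trans hlt)
  refine ⟨by simpa using hconn.1, fun u hu v hv ↦ ?_⟩
  refine Relation.reflTransGen_closed ?_ _ _ (hconn.2 u (by simpa using hu) v (by simpa using hv))
  rintro x y ⟨f, hf⟩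
  obtain ⟨hf, hxX, hyX⟩ := (deleteVerts_isLink G X).1 hf
  obtain hfe | rfl := ne_or_eq f e
  · exact .single ⟨f, by simp [*]⟩
  obtain rfl | hxy := eq_or_ne x y
  · exact .refl
  -- Replace the deleted edge `xy` by a path through a third vertex `w`: one from `x` to `w` that
  -- avoids `y`, followed by one from `w` to `y` that avoids `x`.
  obtain ⟨w, hw, hwX⟩ : ∃ w ∈ V(G), w ∉ insert x (insert y X) :=
    exists_mem_notMem_of_encard_lt_encard <| ((encard_insert_le _ x).trans
      (Order.add_one_le_of_lt (hins y))).trans_lt hG.1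
  simp only [mem_insert_iff, not_or] at hwX
  have hxw := reflTransGen_adj_deleteEdges (a := x) (b := w) hf.inc_right
    (hG.2 _ (insert_subset hf.right_mem hXV) (hins y)) (by simp [*, hf.left_mem]) (by simp [*])
  have hwy := reflTransGen_adj_deleteEdges (a := w) (b := y) hf.inc_left
    (hG.2 _ (insert_subset hf.left_mem hXV) (hins x)) (by simp [*])
    (by simp [*, hf.right_mem, hxy.symm])
  exact hxw.trans hwy

theorem isNConnected_deleteEdges {m : ℕ} (hG : G.IsNConnected (n + m)) {F : Set β}
    (hF : F.encard = m) : (G.deleteEdges F).IsNConnected n := by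
  induction m generalizing G F with
  | zero => simpa [encard_eq_zero.1 (by simpa using hF)] using hG
  | succ m ih =>
    obtain ⟨e, he⟩ : F.Nonempty := encard_pos.1 (hF ▸ ENat.natCast_lt_natCast.2 m.succ_pos)
    rw [← insert_sdiff_self_of_mem he, insert_eq, ← deleteEdges_deleteEdges]
    refine ih (isNConnected_deleteEdges_singleton hG e) ?_
    rwa [← encard_sdiff_singleton_add_one he, Nat.cast_succ,
      (ENat.add_left_injective_of_ne_top ENat.one_ne_top).eq_iff] at hF

theorem isNEdgeConnected_of_isNConnected (hG : G.IsNConnected n) : IsNEdgeConnected G n := by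
  intro F _ hFn
  lift F.encard to ℕ using hFn.ne_top with m hm
  obtain ⟨d, rfl⟩ := Nat.exists_eq_add_of_lt (ENat.natCast_lt_natCast.1 hFn)
  rw [add_assoc, add_comm] at hG
  simpa using (isNConnected_deleteEdges hG hm.symm).2 ∅ (empty_subset _) (by simp)

/-! ### Complements of vertex stars -/

theorem edgeSet_deleteVerts_singleton (G : Graph α β) (x : α) :
    E(G.deleteVerts {x}) = E(G) \ G.vertexStar x := by
  ext e
  simp only [edgeSet_deleteVerts, vertexStar, mem_sdiff, mem_ofPred_eq, mem_singleton_iff]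
  constructor
  · rintro ⟨u, v, he, hu, hv⟩
    refine ⟨he.edge_mem, fun hx ↦ ?_⟩
    obtain rfl | rfl := hx.eq_or_eq_of_isLink he
    exacts [hu rfl, hv rfl]
  · rintro ⟨he, hx⟩
    obtain ⟨u, v, he⟩ := G.exists_isLink_of_mem_edgeSet he
    refine ⟨u, v, he, ?_, ?_⟩
    · rintro rfl; exact hx he.inc_left
    · rintro rfl; exact hx he.inc_right

theorem eRank_le_encard_ground_sdiff {M : Matroid β} (hfin : M.E.Finite) (hSE : S ⊆ M.E)
    (hS : S.encard ≤ M✶.eRank) : M.eRank ≤ (M.E \ S).encard := by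
  refine (ENat.add_le_add_iff_right (hfin.subset hSE).encard_lt_top.ne).1 ?_
  rw [encard_sdiff_add_encard_of_subset hSE, ← M.eRank_add_eRank_dual]
  gcongr

theorem dep_ground_of_encard_le_eRank_dual {M : Matroid β} (hfin : M.E.Finite) (hSE : S ⊆ M.E)
    (hne : S.Nonempty) (hS : S.encard ≤ M✶.eRank) : M.Dep M.E := by
  rw [← Matroid.not_indep_iff]
  intro hind
  have hlt : (M.E \ S).encard < M.E.encard :=
    (hfin.subset sdiff_subset).encard_lt_encard (hSE.sdiff_ssubset_of_nonempty hne)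
  exact hlt.not_ge (hind.encard_le_eRank.trans (eRank_le_encard_ground_sdiff hfin hSE hS))

theorem vertexStar_subset_edgeSet (G : Graph α β) (x : α) : G.vertexStar x ⊆ E(G) :=
  fun _ he ↦ he.edge_mem

theorem ends_compl_vertexStar_subset (G : Graph α β) (x : α) :
    G.ends (E(G) \ G.vertexStar x) ⊆ V(G) \ {x} := by
  rintro v ⟨e, he, hv⟩
  exact ⟨hv.vertex_mem, by rintro rfl; exact he.2 hv⟩

theorem dep_compl_vertexStar (hG : G.IsConnected) (hfin : E(G).Finite) (hx : x ∈ V(G))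
    (hne : (G.vertexStar x).Nonempty)
    (hs : (G.vertexStar x).encard ≤ (G.kCircularMatroid k hk)✶.eRank) :
    (G.kCircularMatroid k hk).Dep (E(G) \ G.vertexStar x) := by
  set M := G.kCircularMatroid k hk
  have hS : G.vertexStar x ⊆ E(G) := vertexStar_subset_edgeSet G x
  have hdep : M.Dep E(G) := dep_ground_of_encard_le_eRank_dual (S := G.vertexStar x) hfin hS hne hs
  have hrank : M.eRank + 1 = V(G).encard + k := by
    rw [← M.eRk_ground]
    exact eRk_add_one_of_isConnected le_rfl hG hfin hdep
  rw [← Matroid.not_indep_iff (sdiff_subset : E(G) \ G.vertexStar x ⊆ M.E)]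
  intro hind
  have hle : V(G).encard + k ≤ (V(G) \ {x}).encard + k := calc
    V(G).encard + k = M.eRank + 1 := hrank.symm
    _ ≤ (E(G) \ G.vertexStar x).encard + 1 := by
      gcongr
      exact eRank_le_encard_ground_sdiff (M := M) hfin hS hs
    _ ≤ (G.ends (E(G) \ G.vertexStar x)).encard + k := encard_add_one_le_of_indep hind
    _ ≤ (V(G) \ {x}).encard + k := by gcongr; exact ends_compl_vertexStar_subset G x
  have hVfin : (V(G) \ {x}).encard ≠ ⊤ := by
    have hMfin : M.eRank < ⊤ := M.eRank_le_encard_ground.trans_lt hfin.encard_lt_top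
    have hlt : V(G).encard + k < ⊤ := hrank ▸ ENat.add_lt_top.2 ⟨hMfin, ENat.one_lt_top⟩
    exact ((encard_le_encard sdiff_subset).trans_lt (le_self_add.trans_lt hlt)).ne
  rw [ENat.add_le_add_iff_right (ENat.natCast_ne_top k), ← encard_sdiff_singleton_add_one hx] at hle
  exact ((ENat.lt_add_one_iff hVfin).2 le_rfl).not_ge hle

theorem IsCyclicSet.closure_eq_compl_vertexStar (hX : IsCyclicSet (G.kCircularMatroid k hk) X)
    (hne : X.Nonempty) (hfin : X.Finite) (hends : G.ends X = V(G) \ {x}) :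
    (G.kCircularMatroid k hk).closure X = E(G) \ G.vertexStar x := by
  rw [hX.closure_eq hne hfin, hends]
  ext e
  simp only [mem_ofPred_eq, mem_sdiff, ends_singleton_subset_iff, mem_singleton_iff]
  exact and_congr_right fun _ ↦ ⟨fun h hx ↦ (h x hx).2 rfl,
    fun h v hv ↦ ⟨hv.vertex_mem, by rintro rfl; exact h hv⟩⟩

theorem encard_ends_eq_of_isCyclicSet
    (hM : G'.kCircularMatroid k hk = G.kCircularMatroid k hk)
    (hX : IsCyclicSet (G.kCircularMatroid k hk) X) (hne : X.Nonempty) (hfin : X.Finite) :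
    (G'.ends X).encard = (G.ends X).encard := by
  have h := hX.eRk_add_one hne hfin
  have h' := (hM ▸ hX : IsCyclicSet (G'.kCircularMatroid k hk) X).eRk_add_one hne hfin
  rw [hM, h] at h'
  exact (ENat.add_left_injective_of_ne_top (ENat.natCast_ne_top k) h').symm

theorem encard_pair_le (x y : α) : ({x, y} : Set α).encard ≤ 2 := by
  simpa [one_add_one_eq_two] using encard_insert_le {y} x

theorem nontrivial_vertexSet_deleteVerts_singleton (hV : 2 < V(G).encard)
    (hx : x ∈ V(G)) : V(G.deleteVerts {x}).Nontrivial := by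
  rw [vertexSet_deleteVerts, ← one_lt_encard_iff_nontrivial,
    ← ENat.add_lt_add_iff_right ENat.one_ne_top, encard_sdiff_singleton_add_one hx,
    one_add_one_eq_two]
  exact hV

theorem isConnected_of_forall_deleteVerts_singleton (hV : 2 < V(G).encard)
    (hconn : ∀ x ∈ V(G), (G.deleteVerts {x}).IsConnected) : G.IsConnected := by
  refine ⟨nonempty_of_encard_ne_zero hV.ne_bot, fun u hu v hv ↦ ?_⟩
  obtain ⟨z, hz, hzuv⟩ := exists_mem_notMem_of_encard_lt_encard ((encard_pair_le u v).trans_lt hV)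
  simp only [mem_insert_iff, mem_singleton_iff, not_or] at hzuv
  exact Relation.ReflTransGen.mono (fun _ _ ↦ Adj.mono deleteVerts_le) _ _
    ((hconn z hz).2 u (by simp [hu, Ne.symm hzuv.1]) v (by simp [hv, Ne.symm hzuv.2]))

theorem injOn_vertexStar (hV : 2 < V(G).encard)
    (hconn : ∀ x ∈ V(G), (G.deleteVerts {x}).IsConnected) : InjOn G.vertexStar V(G) := by
  intro x hx y hy hxy
  by_contra hne
  obtain ⟨e, he⟩ := vertexStar_nonempty_of_isConnected (hconn y hy)
    (nontrivial_vertexSet_deleteVerts_singleton hV hy) (x := x) (by simp [hx, hne])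
  have hey := he.edge_mem
  rw [edgeSet_deleteVerts_singleton, ← hxy] at hey
  exact hey.2 (he.mono deleteVerts_le)

theorem ends_compl_vertexStar (hV : 2 < V(G).encard) (hx : x ∈ V(G))
    (hconn : (G.deleteVerts {x}).IsConnected) :
    G.ends (E(G) \ G.vertexStar x) = V(G) \ {x} := by
  rw [← edgeSet_deleteVerts_singleton, ← ends_eq_of_le deleteVerts_le subset_rfl,
    ends_edgeSet fun _ ↦ vertexStar_nonempty_of_isConnected hconn
      (nontrivial_vertexSet_deleteVerts_singleton hV hx), vertexSet_deleteVerts]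

theorem compl_vertexStar_nonempty (hV : 2 < V(G).encard) (hx : x ∈ V(G))
    (hconn : (G.deleteVerts {x}).IsConnected) : (E(G) \ G.vertexStar x).Nonempty := by
  obtain ⟨y, hy⟩ := (nontrivial_vertexSet_deleteVerts_singleton hV hx).nonempty
  rw [vertexSet_deleteVerts, ← ends_compl_vertexStar hV hx hconn] at hy
  exact hy.imp fun _ he ↦ he.1

theorem isCyclicSet_compl_vertexStar (hE : E(G).Finite) (hG : G.IsConnected)
    (hV : V(G).Nontrivial) (hx : x ∈ V(G))
    (hconn : IsNEdgeConnected (G.deleteVerts {x}) 2)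
    (hs : (G.vertexStar x).encard ≤ (G.kCircularMatroid k hk)✶.eRank) :
    IsCyclicSet (G.kCircularMatroid k hk) (E(G) \ G.vertexStar x) := by
  have hdep := dep_compl_vertexStar hG hE hx (vertexStar_nonempty_of_isConnected hG hV hx) hs
  rw [← edgeSet_deleteVerts_singleton] at hdep ⊢
  exact isCyclicSet_of_isNEdgeConnected_two deleteVerts_le hconn
    (hE.subset deleteVerts_le.edgeSet_mono) hdep

theorem isCyclicSet_edgeSet {M : Matroid β} (hV : 2 < V(G).encard)
    (hcyc : ∀ x ∈ V(G), IsCyclicSet M (E(G) \ G.vertexStar x)) : IsCyclicSet M E(G) := by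
  intro e he
  obtain ⟨u, v, huv⟩ := G.exists_isLink_of_mem_edgeSet he
  obtain ⟨x, hx, hxuv⟩ := exists_mem_notMem_of_encard_lt_encard ((encard_pair_le u v).trans_lt hV)
  have hex : e ∉ G.vertexStar x := fun h ↦ hxuv (h.eq_or_eq_of_isLink huv)
  exact M.closure_subset_closure (sdiff_subset_sdiff_left sdiff_subset) (hcyc x hx e ⟨he, hex⟩)

theorem exists_vertexStar_eq (hM : G'.kCircularMatroid k hk = G.kCircularMatroid k hk)
    (hfin : (E(G) \ G.vertexStar x).Finite) (hne : (E(G) \ G.vertexStar x).Nonempty)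
    (hVV : V(G').encard = V(G).encard) (hx : x ∈ V(G))
    (hcyc : IsCyclicSet (G.kCircularMatroid k hk) (E(G) \ G.vertexStar x))
    (hends : G.ends (E(G) \ G.vertexStar x) = V(G) \ {x}) :
    ∃ x' ∈ V(G'), G'.vertexStar x' = G.vertexStar x := by
  set X := E(G) \ G.vertexStar x
  have hEE : E(G') = E(G) := congrArg Matroid.E hM
  have hcount : (V(G') \ G'.ends X).encard + (G'.ends X).encard = 1 + (G'.ends X).encard := by
    rw [encard_sdiff_add_encard_of_subset (ends_subset_vertexSet G' X), hVV,
      encard_ends_eq_of_isCyclicSet hM hcyc hne hfin, hends, add_comm,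
      encard_sdiff_singleton_add_one hx]
  obtain ⟨x', hx'⟩ := encard_eq_one.1 <|
    ENat.add_left_injective_of_ne_top (G'.ends_finite hfin).encard_lt_top.ne hcount
  have hends' : G'.ends X = V(G') \ {x'} := by
    rw [← hx', sdiff_sdiff_cancel_left (ends_subset_vertexSet G' X)]
  have hcompl : E(G) \ G'.vertexStar x' = E(G) \ G.vertexStar x := by
    rw [← hcyc.closure_eq_compl_vertexStar hne hfin hends, ← hEE, ← hM]
    exact ((hM ▸ hcyc).closure_eq_compl_vertexStar hne hfin hends').symm
  refine ⟨x', (hx'.ge rfl).1, ?_⟩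
  rw [← sdiff_sdiff_cancel_left (vertexStar_subset_edgeSet G x), ← hcompl, ← hEE,
    sdiff_sdiff_cancel_left (vertexStar_subset_edgeSet G' x')]

theorem image_eq_and_injOn_of_image_subset {γ : Type*} {f : α → γ} {g : α' → γ} {s : Set α}
    {t : Set α'} (hf : InjOn f s) (ht : t.Finite) (hst : f '' s ⊆ g '' t)
    (hcard : t.encard = s.encard) : f '' s = g '' t ∧ InjOn g t := by
  rw [← hf.encard_image] at hcard
  have himage : f '' s = g '' t :=
    (ht.image g).eq_of_subset_of_encard_le' hst ((encard_image_le g t).trans hcard.le)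
  exact ⟨himage, ht.injOn_of_encard_image_eq (by rw [← himage, hcard])⟩

theorem stronglyIsomorphic_of_vertexStars_eq (hE : E(G) = E(G')) (hG : InjOn G.vertexStar V(G))
    (hG' : InjOn G'.vertexStar V(G')) (h : G.vertexStars = G'.vertexStars) :
    G.StronglyIsomorphic G' := by
  let ν : V(G) ≃ V(G') := (Equiv.Set.imageOfInjOn _ _ hG).trans
    ((Equiv.setCongr h).trans (Equiv.Set.imageOfInjOn _ _ hG').symm)
  have hν (x : V(G)) : G'.vertexStar (ν x) = G.vertexStar x :=
    congrArg Subtype.val <| (Equiv.Set.imageOfInjOn _ _ hG').apply_symm_apply _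
  have hinc (e : β) (x : V(G)) : G.Inc e x ↔ G'.Inc e (ν x) := (Set.ext_iff.1 (hν x) e).symm
  refine ⟨hE, ν, fun e x y ↦ ?_⟩
  rw [isLink_iff_inc, isLink_iff_inc, hinc, hinc]
  refine and_congr_right fun _ ↦ and_congr_right fun _ ↦ ⟨fun h z hz ↦ ?_, fun h z hz ↦ ?_⟩
  · obtain ⟨w, rfl⟩ : ∃ w, z = ν w := ⟨ν.symm ⟨z, hz.vertex_mem⟩, by simp⟩
    simpa only [Subtype.val_inj, ν.injective.eq_iff] using h w ((hinc e w).2 hz)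
  · lift z to V(G) using hz.vertex_mem
    simpa only [Subtype.val_inj, ν.injective.eq_iff] using h (ν z) ((hinc e z).1 hz)

end KCircular

open Set Graph KCircular in
theorem mainTheorem3_general {α α' β : Type*} (G : Graph α β) (G' : Graph α' β)
    (hE : E(G).Finite) (k : ℕ) (hk : 1 ≤ k) (hV : 2 < V(G).encard)
    (hconn : ∀ x ∈ V(G), IsNEdgeConnected (G.deleteVerts {x}) 2)
    (hs : ∀ x ∈ V(G), (G.vertexStar x).encard ≤ (G.kCircularMatroid k hk)✶.eRank)
    (hiso : ∀ x ∈ V(G'), (G'.vertexStar x).Nonempty)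
    (hM : G'.kCircularMatroid k hk = G.kCircularMatroid k hk) :
    G.vertexStars = G'.vertexStars ∧ G.StronglyIsomorphic G' := by
  have hEE : E(G') = E(G) := congrArg Matroid.E hM
  have hconn' (x) (hx : x ∈ V(G)) : (G.deleteVerts {x}).IsConnected :=
    (hconn x hx).isConnected one_le_two
  have hG : G.IsConnected := isConnected_of_forall_deleteVerts_singleton hV hconn'
  have hVnt : V(G).Nontrivial := one_lt_encard_iff_nontrivial.1 (lt_trans (by norm_num) hV)
  have hiso' : ∀ x ∈ V(G), (G.vertexStar x).Nonempty :=
    fun x ↦ vertexStar_nonempty_of_isConnected hG hVnt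
  have hcyc (x) (hx : x ∈ V(G)) : IsCyclicSet (G.kCircularMatroid k hk) (E(G) \ G.vertexStar x) :=
    isCyclicSet_compl_vertexStar hE hG hVnt hx (hconn x hx) (hs x hx)
  have hEne : E(G).Nonempty :=
    let ⟨x, hx⟩ := hG.1
    (hiso' x hx).mono (vertexStar_subset_edgeSet G x)
  have hVV : V(G').encard = V(G).encard := by
    rw [← ends_edgeSet hiso, ← ends_edgeSet hiso', hEE]
    exact encard_ends_eq_of_isCyclicSet hM (isCyclicSet_edgeSet hV hcyc) hEne hE
  have hsub : G.vertexStars ⊆ G'.vertexStars := by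
    rintro _ ⟨x, hx, rfl⟩
    exact exists_vertexStar_eq hM (hE.subset sdiff_subset)
      (compl_vertexStar_nonempty hV hx (hconn' x hx)) hVV hx (hcyc x hx)
      (ends_compl_vertexStar hV hx (hconn' x hx))
  have hVfin : V(G').Finite := ends_edgeSet hiso ▸ G'.ends_finite (hEE ▸ hE)
  have hinj := injOn_vertexStar hV hconn'
  obtain ⟨hstars, hinj'⟩ := image_eq_and_injOn_of_image_subset hinj hVfin hsub hVV
  exact ⟨hstars, stronglyIsomorphic_of_vertexStars_eq hEE.symm hinj hinj' hstars⟩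

theorem mainTheorem3 {α α' β : Type*} (G : Graph α β) (G' : Graph α' β)
    (hV : V(G).Finite) (hE : E(G).Finite) (hV' : V(G').Finite) (hE' : E(G').Finite)
    (k : ℕ) (hk : 1 ≤ k)
    (h3 : G.IsNConnected 3)
    (hC : (G.kCircuits k).Nonempty)
    (hs : ∀ x ∈ V(G), (G.vertexStar x).encard ≤ (G.kCircularMatroid k hk)✶.eRank)
    (hiso : ∀ x ∈ V(G'), (G'.vertexStar x).Nonempty)
    (hM : G'.kCircularMatroid k hk = G.kCircularMatroid k hk) :
    G.vertexStars = G'.vertexStars ∧ G.StronglyIsomorphic G' :=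
  mainTheorem3_general G G' hE k hk (lt_trans (by norm_num) h3.1) (fun _ hx ↦
    KCircular.isNEdgeConnected_of_isNConnected
      (KCircular.isNConnected_deleteVerts_singleton h3 hx)) hs hiso hM
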